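/- Let $F$ be the space of all finite non-empty subsets of $\mathbb{C}$, topologized by the basic open sets $U_{\{O_i\}_{i\in I},N}=\{A\in F : A\cap O_i\neq\emptyset \text{ for all } i\in I,\ A\subseteq N\}$ with $I$ finite and $O_i,N\subseteq\mathbb{C}$ open; such a set is in normal form if $N=\bigcup_{i\in I} O_i$. Work in the topological (sheaf) model over $F$, whose truth values are the open subsets of $F$ and whose real and complex numbers are those given by Dedekind cuts; every ground-model number is identified with its canonical copy in the model. Let $H$ be the largest set of complex numbers of the model such that every basic open set $U_{\{O_i\},\bigcup_i O_i}$ in normal form forces $H\subseteq\bigcup_i O_i$ (with $\bigcup_i O_i$ reinterpreted in the model). Let $R$ be the Riesz space of functions $\mathbb{C}\to\mathbb{R}$ generated by the constant $1$ and the coordinate projections $x,y$, and let $R'$ be the space obtained from the same generators by closing under the Riesz space operations and squaring. They are regarded as Riesz spaces of the model by letting $U_{\{O_i\},N}$ force $r=s$ if $r$ and $s$ agree on $N$, with $r\le s$ meaning $r\wedge s=r$. For such an $r$, and for rational $q$, let $q<r$ mean that $p\cdot 1\le r$ for some rational $p>q$; $\inf(r)$ denotes the real number of the model (if it is one) with lower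 cut $\{q\in\mathbb{Q} : q<r\}$ and upper cut $\{q\in\mathbb{Q} : \neg(p<r)\text{ for some rational } p<q\}$. Then $H$ has no points: no non-empty open subset of $F$ forces any $z$ to be in $H$. Nevertheless there is in the model a non-trivial distance function to $H$, both for the taxicab metric and for the Euclidean metric $m$ on $\mathbb{C}$. That is, for each of the two metrics there is a function $d(\cdot,H):\mathbb{C}\to\mathbb{R}$ of the model such that: 1. for every ground-model $z=(x_z,y_z)\in\mathbb{C}$: in the taxicab case $|x-x_z|+|y-y_z|\in R$ and $$d(z,H)=\inf\bigl(|x-x_z|+|y-y_z|\bigr),$$ computed in $R$; in the Euclidean case $|x-x_z|^2+|y-y_z|^2\in R'$ and $$d(z,H)=\sqrt{\inf\bigl(|x-x_z|^2+|y-y_z|^2\bigr)},$$ the infimum being computed in $R'$; in particular these infima exist as real numbers of the model; 2. the model satisfies, for all of its complex numbers $z,w$: $d(z,H)\ge 0$; $d(z,H)-d(w,H)\le m(z,w)$; and $d(z,H)=0$ if and only if $z\in H$; 3. if $U$ is a basic open set in normal form, with positive information $\{O_i\}$, and $z\in\mathbb{C}$, then $U$ forces $\rho\le d(z,H)$ for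 every rational $\rho$ that is at most $m(z,w)$ for all $w\in\bigcup_i O_i$; and if moreover each two points of a single $O_i$ are at $m$-distance less than $\varepsilon$, then $U$ forces $d(z,H)<q$ for every rational $q$ with $q\ge m(z,w)+\varepsilon$ for some $w\in\bigcup_i O_i$ (so $d(z,H)$ lies between the distance from $z$ to $\bigcup_i O_i$ and that distance plus $\varepsilon$); 4. the model satisfies that $d(\cdot,H)$ takes values below every rational $\varepsilon>0$ and values above every rational $K$, already at ground-model points $z$. -/

import Mathlib

open TopologicalSpace

namespace PointlessModel

/-! ### The space of finite non-empty sets of complex numbers -/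

/-- The finite non-empty subsets of `ℂ`. -/
def F : Type := {A : Set ℂ // A.Finite ∧ A.Nonempty}

/-- The set of all `A` in `F` that meet every member of `P` (the positive information) and are
contained in `N` (the negative information). -/
def basicSet (P : Set (Opens ℂ)) (N : Opens ℂ) : Set F :=
  {A | (∀ O ∈ P, (A.1 ∩ (O : Set ℂ)).Nonempty) ∧ A.1 ⊆ (N : Set ℂ)}

/-- The topology on `F` generated by the basic sets with finitely many pieces of positive
information. -/
instance instTopologicalSpaceF : TopologicalSpace F :=
  TopologicalSpace.generateFrom {s | ∃ P : Set (Opens ℂ), P.Finite ∧ ∃ N, s = basicSet P N}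

/-- The basic open sets, as elements of the Heyting algebra of truth values. -/
noncomputable def basicOpen (P : Set (Opens ℂ)) (hP : P.Finite) (N : Opens ℂ) : Opens F :=
  ⟨basicSet P N, TopologicalSpace.isOpen_generateFrom_of_mem ⟨P, hP, N, rfl⟩⟩

/-- The basic open set in normal form with positive information `P`: the negative information
is the union of `P`. -/
noncomputable def normalOpen (P : Set (Opens ℂ)) (hP : P.Finite) : Opens F :=
  basicOpen P hP (sSup P)

/-! ### The Dedekind real and complex numbers of the sheaf model over `F`

Truth values are the open sets of `F`.  A subset of the rationals of the model, at the stage `V`,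
is a family of opens `q ↦ ⟦q ∈ S⟧ ≤ V` indexed by the (external) rationals. -/

/-- The real numbers of the model at the stage `V`: pairs of families of truth values that are
forced by `V` to be a Dedekind cut.  Here `lower q` is the truth value of `q < x` and `upper q`
that of `x < q`. -/
@[ext]
structure DReal (V : Opens F) where
  lower : ℚ → Opens F
  upper : ℚ → Opens F
  lower_le : ∀ q, lower q ≤ V
  upper_le : ∀ q, upper q ≤ V
  lower_inhabited : V ≤ ⨆ q, lower q
  upper_inhabited : V ≤ ⨆ q, upper q
  lower_rounded : ∀ q, lower q = ⨆ (p : ℚ) (_ : q < p), lower p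
  upper_rounded : ∀ q, upper q = ⨆ (p : ℚ) (_ : p < q), upper p
  disjoint : ∀ q, lower q ⊓ upper q = ⊥
  located : ∀ p q, p < q → V ≤ lower p ⊔ upper q

/-- Restriction of a real number of the model to a smaller stage. -/
def DReal.restrict {V W : Opens F} (h : W ≤ V) (x : DReal V) : DReal W where
  lower q := x.lower q ⊓ W
  upper q := x.upper q ⊓ W
  lower_le _ := inf_le_right
  upper_le _ := inf_le_right
  lower_inhabited := by
    rw [← iSup_inf_eq]; exact le_inf (h.trans x.lower_inhabited) le_rfl
  upper_inhabited := by
    rw [← iSup_inf_eq]; exact le_inf (h.trans x.upper_inhabited) le_rfl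
  lower_rounded q := by
    conv_lhs => rw [x.lower_rounded q]
    simp only [iSup_inf_eq]
  upper_rounded q := by
    conv_lhs => rw [x.upper_rounded q]
    simp only [iSup_inf_eq]
  disjoint q := by
    rw [← inf_inf_distrib_right, x.disjoint q, bot_inf_eq]
  located p q hpq := by
    rw [← inf_sup_right]; exact le_inf (h.trans (x.located p q hpq)) le_rfl

/-- The complex numbers of the model at the stage `V`. -/
@[ext]
structure DComplex (V : Opens F) where
  re : DReal V
  im : DReal V

/-- Restriction of a complex number of the model to a smaller stage. -/
def DComplex.restrict {V W : Opens F} (h : W ≤ V) (z : DComplex V) : DComplex W :=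
  ⟨z.re.restrict h, z.im.restrict h⟩

/-- The ground-model real number `r`, as a real number of the model. -/
noncomputable def DReal.const (r : ℝ) : DReal ⊤ where
  lower q := ⨆ _ : (q : ℝ) < r, ⊤
  upper q := ⨆ _ : r < (q : ℝ), ⊤
  lower_le _ := le_top
  upper_le _ := le_top
  lower_inhabited := by
    obtain ⟨q, hq⟩ := exists_rat_lt r
    exact le_iSup_of_le q (le_iSup_of_le hq le_rfl)
  upper_inhabited := by
    obtain ⟨q, hq⟩ := exists_rat_gt r
    exact le_iSup_of_le q (le_iSup_of_le hq le_rfl)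
  lower_rounded q := by
    apply le_antisymm
    · refine iSup_le fun h => ?_
      obtain ⟨p, hp, hp'⟩ := exists_rat_btwn h
      exact le_iSup_of_le p (le_iSup_of_le (by exact_mod_cast hp) (le_iSup_of_le hp' le_rfl))
    · refine iSup_le fun p => iSup_le fun hp => iSup_le fun h => ?_
      exact le_iSup_of_le (lt_trans (by exact_mod_cast hp) h) le_rfl
  upper_rounded q := by
    apply le_antisymm
    · refine iSup_le fun h => ?_
      obtain ⟨p, hp, hp'⟩ := exists_rat_btwn h
      exact le_iSup_of_le p (le_iSup_of_le (by exact_mod_cast hp') (le_iSup_of_le hp le_rfl))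
    · refine iSup_le fun p => iSup_le fun hp => iSup_le fun h => ?_
      exact le_iSup_of_le (lt_trans h (by exact_mod_cast hp)) le_rfl
  disjoint q := by
    rcases lt_or_ge (q : ℝ) r with h | h
    · simp [not_lt.2 h.le]
    · simp [not_lt.2 h]
  located p q hpq := by
    rcases lt_or_ge (p : ℝ) r with h | h
    · exact le_sup_of_le_left (le_iSup_of_le h le_rfl)
    · have h' : r < (q : ℝ) := lt_of_le_of_lt h (by exact_mod_cast hpq)
      exact le_sup_of_le_right (le_iSup_of_le h' le_rfl)

/-- The ground-model complex number `z`, as a complex number of the model. -/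
noncomputable def DComplex.const (z : ℂ) : DComplex ⊤ := ⟨DReal.const z.re, DReal.const z.im⟩

/-- A function of the model from its complex numbers to its real numbers: a morphism of
sheaves. -/
structure DFun where
  app : ∀ V : Opens F, DComplex V → DReal V
  app_restrict : ∀ (V W : Opens F) (h : W ≤ V) (z : DComplex V),
    app W (z.restrict h) = (app V z).restrict h

/-! ### Truth values of some statements about numbers of the model -/

/-- The truth value of `x - y < q`: some rational `s` has `x < s + q` and `s < y`. -/
def subLt {V : Opens F} (x y : DReal V) (q : ℚ) : Opens F :=
  ⨆ s : ℚ, x.upper (s + q) ⊓ y.lower s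

/-- The truth value of `|x - y| < q`. -/
def absSubLt {V : Opens F} (x y : DReal V) (q : ℚ) : Opens F :=
  subLt x y q ⊓ subLt y x q

/-- The truth value of `|re z - re w| + |im z - im w| < q`. -/
def taxiLt (V : Opens F) (z w : DComplex V) (q : ℚ) : Opens F :=
  ⨆ (a : ℚ) (b : ℚ) (_ : a + b ≤ q), absSubLt z.re w.re a ⊓ absSubLt z.im w.im b

/-- The truth value of `√(|re z - re w|² + |im z - im w|²) < q`. -/
def euclidLt (V : Opens F) (z w : DComplex V) (q : ℚ) : Opens F :=
  ⨆ (a : ℚ) (b : ℚ) (_ : 0 < q ∧ a ^ 2 + b ^ 2 ≤ q ^ 2),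
    absSubLt z.re w.re a ⊓ absSubLt z.im w.im b

/-- The truth value of `z ∈ N`, where `N` is reinterpreted in the model as the union of
the open rectangles with rational corners that it contains. -/
noncomputable def memOpen {V : Opens F} (z : DComplex V) (N : Opens ℂ) : Opens F :=
  ⨆ (a : ℚ) (b : ℚ) (c : ℚ) (e : ℚ)
    (_ : ∀ w : ℂ, (a : ℝ) < w.re → w.re < b → (c : ℝ) < w.im → w.im < e → w ∈ N),
    (z.re.lower a ⊓ z.re.upper b) ⊓ (z.im.lower c ⊓ z.im.upper e)

/-- `e` is the non-negative square root of `y`, at the stage `V`: `q < e` iff `q < 0` or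
`q² < y`, and `e < q` iff `0 < q` and `y < q²`. -/
def IsSqrt {V : Opens F} (e y : DReal V) : Prop :=
  (∀ q < 0, e.lower q = V) ∧ (∀ q, 0 ≤ q → e.lower q = y.lower (q ^ 2)) ∧
    (∀ q ≤ 0, e.upper q = ⊥) ∧ (∀ q, 0 < q → e.upper q = y.upper (q ^ 2))

/-! ### The pointless set -/

/-- The truth value of `z ∈ H`.  The set `H` is the largest set of complex numbers of the model
such that every basic open set in normal form forces `H` to be contained in the union of its
positive information. -/
noncomputable def memH {V : Opens F} (z : DComplex V) : Opens F :=
  V ⊓ ⨅ (P : Set (Opens ℂ)) (hP : P.Finite), (normalOpen P hP ⇨ memOpen z (sSup P))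

/-! ### The Riesz space of the model -/

/-- A set of functions closed under the Riesz space operations. -/
structure IsRieszSubspace (S : Set (ℂ → ℝ)) : Prop where
  zero_mem : 0 ∈ S
  add_mem : ∀ f ∈ S, ∀ g ∈ S, f + g ∈ S
  smul_mem : ∀ (c : ℝ), ∀ f ∈ S, c • f ∈ S
  sup_mem : ∀ f ∈ S, ∀ g ∈ S, f ⊔ g ∈ S
  inf_mem : ∀ f ∈ S, ∀ g ∈ S, f ⊓ g ∈ S

/-- The generators: the constant `1` and the two coordinate projections. -/
def generators : Set (ℂ → ℝ) := {1, Complex.re, Complex.im}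

/-- The Riesz space `R` generated by the generators. -/
def rieszR : Set (ℂ → ℝ) :=
  ⋂₀ {S | IsRieszSubspace S ∧ generators ⊆ S}

/-- The enlarged Riesz space, generated under the Riesz space operations and squaring. -/
def rieszRSq : Set (ℂ → ℝ) :=
  ⋂₀ {S | IsRieszSubspace S ∧ (∀ f ∈ S, f ^ 2 ∈ S) ∧ generators ⊆ S}

/-- The truth value of `r = s` in the Riesz space of the model: a basic open set with negative
information `N` forces it if `r` and `s` agree on `N`. -/
noncomputable def rieszEq (r s : ℂ → ℝ) : Opens F :=
  ⨆ (P : Set (Opens ℂ)) (hP : P.Finite) (N : Opens ℂ) (_ : ∀ w ∈ N, r w = s w), basicOpen P hP N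

/-- The truth value of `r ≤ s` in the Riesz space of the model. -/
noncomputable def rieszLe (r s : ℂ → ℝ) : Opens F := rieszEq (r ⊓ s) r

/-- The truth value of `q < r` in the Riesz space of the model: `p • 1 ≤ r` for some rational
`p > q`. -/
noncomputable def rieszRatLt (q : ℚ) (r : ℂ → ℝ) : Opens F :=
  ⨆ (p : ℚ) (_ : q < p), rieszLe ((p : ℝ) • (1 : ℂ → ℝ)) r

/-- The real number `x` of the model is the infimum of the element `r` of the Riesz space of the
model: its lower cut is `{q | q < r}`, and `x < q` means that `¬ (p < r)` for some `p < q`. -/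
def IsRieszInf (r : ℂ → ℝ) (x : DReal ⊤) : Prop :=
  (∀ q, x.lower q = rieszRatLt q r) ∧
    (∀ q, x.upper q = ⨆ (p : ℚ) (_ : p < q), (rieszRatLt p r)ᶜ)

/-! ### Non-trivial distance functions to the pointless set -/

/-- The taxicab metric on `ℂ`. -/
noncomputable def taxi (z w : ℂ) : ℝ := |z.re - w.re| + |z.im - w.im|

/-- The element `|x - x_z| + |y - y_z|` of `R`. -/
noncomputable def taxiElt (z : ℂ) : ℂ → ℝ := fun w => |w.re - z.re| + |w.im - z.im|

/-- The element `|x - x_z|² + |y - y_z|²` of the enlarged Riesz space. -/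
noncomputable def euclidElt (z : ℂ) : ℂ → ℝ := fun w => |w.re - z.re| ^ 2 + |w.im - z.im| ^ 2

/-- `d` is, in the model, a non-trivial distance function to `H`, with respect to the
metric `m` on `ℂ` that is given inside the model by the truth values `mLt V z w q` of
`m(z, w) < q`. -/
structure IsNontrivialDistanceToH (m : ℂ → ℂ → ℝ)
    (mLt : ∀ V : Opens F, DComplex V → DComplex V → ℚ → Opens F) (d : DFun) : Prop where
  /-- `d ≥ 0`. -/
  nonneg : ∀ (V : Opens F) (z : DComplex V), ∀ q < 0, (d.app V z).lower q = V
  /-- `d(z) - d(w) ≤ m(z, w)`. -/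
  lipschitz : ∀ (V : Opens F) (z w : DComplex V) (q : ℚ),
    mLt V z w q ≤ subLt (d.app V z) (d.app V w) q
  /-- `d(z) = 0`, which means `¬ (0 < d(z))`, exactly if `z ∈ H`. -/
  zero_iff : ∀ (V : Opens F) (z : DComplex V), V ⊓ ((d.app V z).lower 0)ᶜ = memH z
  /-- A basic open set in normal form forces `d(z)` to be at least the distance from `z` to the
  union `N` of its positive information. -/
  lower_bound : ∀ (P : Set (Opens ℂ)) (hP : P.Finite) (z : ℂ) (q : ℚ),
    (∀ w ∈ sSup P, (q : ℝ) ≤ m z w) →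
      normalOpen P hP ⊓ (d.app ⊤ (DComplex.const z)).upper q = ⊥
  /-- If moreover its positive pieces have `m`-diameter less than `ε`, then it forces `d(z)` to be
  at most that distance plus `ε`. -/
  upper_bound : ∀ (P : Set (Opens ℂ)) (hP : P.Finite) (ε : ℝ) (z : ℂ) (q : ℚ),
    (∀ O ∈ P, ∀ a ∈ O, ∀ b ∈ O, m a b < ε) →
      (∃ w ∈ sSup P, m z w + ε ≤ q) →
        normalOpen P hP ≤ (d.app ⊤ (DComplex.const z)).upper q
  /-- `d` takes arbitrarily small values. -/
  exists_small : ∀ ε : ℚ, 0 < ε → (⨆ z : ℂ, (d.app ⊤ (DComplex.const z)).upper ε) = ⊤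
  /-- `d` takes arbitrarily large values. -/
  exists_large : ∀ K : ℚ, (⨆ z : ℂ, (d.app ⊤ (DComplex.const z)).lower K) = ⊤

end PointlessModel

open PointlessModel

namespace PointlessModel

/-!
A truth value of the model is an open set of `F`, a Dedekind real at the stage `V` is a continuous
function `V → ℝ`, and a complex number a continuous function `V → ℂ`. A member of `H` at the stage
`V` would be a continuous `ζ` with `ζ A ∈ A` for all `A ∈ V`. There is none: replace the point
`a = ζ A` of `A` by the pair `a ± u`. For small `u` the function `u ↦ ζ (A \ {a} ∪ {a ± u}) - a` is
continuous and even with values `± u`, but on a circle around `0` a continuous choice of sign is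
constant, so that it is odd.

The distance to `H` is `d(z, H) = (A ↦ min_{a ∈ A} m (z A) a)`, a continuous function for every
continuous `m`. The lower cut of the infimum of `r` in the Riesz space of the model consists of the
`q` with `q < min_A r`, and the upper cut of a Dedekind real is determined by its lower cut.
-/

open Filter Function Set Metric
open scoped Topology

variable {V : Opens F}

/-! ### The topology of `F` -/

section Vietoris

attribute [local instance] TopologicalSpace.vietoris

theorem isInducing_val : Topology.IsInducing (fun A : F => A.1) where
  eq_induced := by
    refine le_antisymm (continuous_iff_le_induced.1 (continuous_generateFrom_iff.2 ?_))
      (le_generateFrom ?_)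
    · rintro _ (⟨U, hU, rfl⟩ | ⟨U, hU, rfl⟩)
      · exact isOpen_generateFrom_of_mem
          ⟨∅, finite_empty, ⟨U, hU⟩, by ext A; simp [basicSet]⟩
      · exact isOpen_generateFrom_of_mem
          ⟨{⟨U, hU⟩}, finite_singleton _, ⊤, by ext A; simp [basicSet]⟩
    · rintro _ ⟨P, hP, N, rfl⟩
      refine ⟨(⋂ O ∈ P, {s | (s ∩ (O : Set ℂ)).Nonempty}) ∩ (N : Set ℂ).powerset, ?_, ?_⟩
      · exact (hP.isOpen_biInter fun O _ => vietoris.isOpen_inter_nonempty_of_isOpen O.2).inter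
          N.2.powerset_vietoris
      · ext A
        simp [basicSet]

theorem isOpen_setOf_inter_nonempty {O : Set ℂ} (hO : IsOpen O) :
    IsOpen {A : F | (A.1 ∩ O).Nonempty} :=
  (vietoris.isOpen_inter_nonempty_of_isOpen hO).preimage isInducing_val.continuous

theorem isOpen_setOf_subset {N : Set ℂ} (hN : IsOpen N) : IsOpen {A : F | A.1 ⊆ N} :=
  hN.powerset_vietoris.preimage isInducing_val.continuous

/-- The set `A` with its point `a` replaced by the two points `a + u` and `a - u`: the perturbation
of `A` that no continuous selection survives. -/
def splitPoint (A : F) (a u : ℂ) : F :=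
  ⟨A.1 \ {a} ∪ ({a + u} ∪ {a - u}), A.2.1.sdiff.union (toFinite _), a + u, Or.inr (Or.inl rfl)⟩

theorem continuous_splitPoint (A : F) (a : ℂ) : Continuous (splitPoint A a) := by
  refine isInducing_val.continuous_iff.2 ?_
  have hadd : Continuous fun u : ℂ => ({a + u} : Set ℂ) :=
    vietoris.continuous_singleton.comp (continuous_const.add continuous_id)
  have hsub : Continuous fun u : ℂ => ({a - u} : Set ℂ) :=
    vietoris.continuous_singleton.comp (continuous_const.sub continuous_id)
  exact vietoris.continuous_union.comp
    (continuous_const.prodMk (vietoris.continuous_union.comp (hadd.prodMk hsub)))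

end Vietoris

theorem splitPoint_zero {A : F} {a : ℂ} (ha : a ∈ A.1) : splitPoint A a 0 = A :=
  Subtype.ext (by simp [splitPoint, ha])

theorem splitPoint_neg (A : F) (a u : ℂ) : splitPoint A a (-u) = splitPoint A a u :=
  Subtype.ext (by simp only [splitPoint, sub_neg_eq_add, ← sub_eq_add_neg, union_comm])

theorem mem_normalOpen {P : Set (Opens ℂ)} {hP : P.Finite} {A : F} :
    A ∈ normalOpen P hP ↔
      (∀ O ∈ P, (A.1 ∩ (O : Set ℂ)).Nonempty) ∧ A.1 ⊆ ((sSup P : Opens ℂ) : Set ℂ) :=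
  Iff.rfl

theorem notMem_of_mem_compl {X : Type*} [TopologicalSpace X] {U : Opens X} {x : X}
    (hx : x ∈ Uᶜ) : x ∉ U :=
  fun hxU => (disjoint_compl_left (a := U)).le_bot ⟨hx, hxU⟩

/-! ### Continuous selections -/

theorem map_neg_of_sq_eq_sq {𝕜 : Type*} [Field 𝕜] [TopologicalSpace 𝕜] [T1Space 𝕜]
    [ContinuousInv₀ 𝕜] [ContinuousMul 𝕜] {S : Set 𝕜} (hS : IsPreconnected S) (h0 : 0 ∉ S)
    {f : 𝕜 → 𝕜} (hf : ContinuousOn f S) (hsq : ∀ u ∈ S, f u ^ 2 = u ^ 2) {u : 𝕜} (hu : u ∈ S)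
    (hnu : -u ∈ S) : f (-u) = -f u := by
  rcases hS.eq_or_eq_neg_of_sq_eq hf continuousOn_id hsq
    (fun hx => ne_of_mem_of_not_mem hx h0) with h | h
  · rw [h hu, h hnu, id, id]
  · rw [h hu, h hnu, Pi.neg_apply, Pi.neg_apply, id, id]

theorem eventually_selection_splitPoint {W : Set F} (hW : IsOpen W) {ζ : F → ℂ}
    (hζ : ContinuousOn ζ W) (hmem : ∀ A ∈ W, ζ A ∈ A.1) {A : F} (hA : A ∈ W) :
    ∀ᶠ u in 𝓝 0, splitPoint A (ζ A) u ∈ W ∧ (ζ (splitPoint A (ζ A) u) - ζ A) ^ 2 = u ^ 2 := by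
  have hsplit : Tendsto (splitPoint A (ζ A)) (𝓝 0) (𝓝 A) := by
    simpa only [splitPoint_zero (hmem A hA)] using (continuous_splitPoint A (ζ A)).tendsto 0
  have hfar : (A.1 \ {ζ A})ᶜ ∈ 𝓝 (ζ A) :=
    A.2.1.sdiff.isClosed.isOpen_compl.mem_nhds fun h => h.2 rfl
  filter_upwards [hsplit (hW.mem_nhds hA),
    hsplit.eventually (hζ.continuousAt (hW.mem_nhds hA) hfar)] with u huW hu
  refine ⟨huW, ?_⟩
  rcases hmem _ huW with h | h | h
  · exact absurd h hu
  · rw [h, add_sub_cancel_left]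
  · rw [mem_singleton_iff.1 h, sub_sub_cancel_left, neg_sq]

theorem eq_empty_of_continuousOn_selection {W : Set F} (hW : IsOpen W) {ζ : F → ℂ}
    (hζ : ContinuousOn ζ W) (hmem : ∀ A ∈ W, ζ A ∈ A.1) : W = ∅ := by
  refine eq_empty_of_forall_notMem fun A hA => ?_
  set f : ℂ → ℂ := fun u => ζ (splitPoint A (ζ A) u) - ζ A with hf
  obtain ⟨r, hr, hball⟩ :=
    nhds_basis_closedBall.eventually_iff.1 (eventually_selection_splitPoint hW hζ hmem hA)
  have hsphere : ∀ u ∈ sphere (0 : ℂ) r, splitPoint A (ζ A) u ∈ W ∧ f u ^ 2 = u ^ 2 :=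
    fun u hu => hball (sphere_subset_closedBall hu)
  have hconn : IsPreconnected (sphere (0 : ℂ) r) :=
    isPreconnected_sphere (by rw [Complex.rank_real_complex]; exact Cardinal.one_lt_two) 0 r
  have hcont : ContinuousOn f (sphere 0 r) :=
    (hζ.comp (continuous_splitPoint A (ζ A)).continuousOn fun u hu => (hsphere u hu).1).sub
      continuousOn_const
  have hr_mem : (r : ℂ) ∈ sphere (0 : ℂ) r := by simp [hr.le]
  have hodd : f (-r) = -f r :=
    map_neg_of_sq_eq_sq hconn (by simp [hr.ne]) hcont (fun u hu => (hsphere u hu).2) hr_mem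
      (by simp [hr.le])
  have heven : f (-r) = f r := by simp only [hf, splitPoint_neg]
  have hfr : f r = 0 := self_eq_neg.1 (heven.symm.trans hodd)
  have hsq := (hsphere r hr_mem).2
  rw [hfr, eq_comm, zero_pow two_ne_zero, sq_eq_zero_iff, Complex.ofReal_eq_zero] at hsq
  exact hr.ne' hsq

/-! ### Numbers of the model as continuous functions -/

namespace DReal

/-- The value at the point `A` of `F` of a real number of the model, regarded as a real function
on its stage; it is meaningful only for `A ∈ V`. -/
noncomputable def eval (x : DReal V) (A : F) : ℝ :=
  sSup ((↑) '' {q : ℚ | A ∈ x.lower q})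

theorem upper_mono (x : DReal V) : Monotone x.upper := by
  intro p q hpq
  rcases hpq.eq_or_lt with rfl | hpq
  · exact le_rfl
  · rw [x.upper_rounded q]
    exact le_iSup₂_of_le p hpq le_rfl

theorem lt_of_mem_lower_of_mem_upper (x : DReal V) {A : F} {p q : ℚ} (hp : A ∈ x.lower p)
    (hq : A ∈ x.upper q) : p < q := by
  by_contra! hqp
  exact (x.disjoint p).le ⟨hp, x.upper_mono hqp hq⟩

theorem mem_lower (x : DReal V) {A : F} {q : ℚ} :
    A ∈ x.lower q ↔ A ∈ V ∧ (q : ℝ) < x.eval A := by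
  rw [← and_iff_right_of_imp (@x.lower_le q A)]
  refine and_congr_right fun hA => ?_
  obtain ⟨u, hu⟩ := Opens.mem_iSup.1 (x.upper_inhabited hA)
  have hne : {q : ℚ | A ∈ x.lower q}.Nonempty := Opens.mem_iSup.1 (x.lower_inhabited hA)
  have hbdd : BddAbove ((↑) '' {q : ℚ | A ∈ x.lower q} : Set ℝ) := by
    refine ⟨u, forall_mem_image.2 fun p hp => ?_⟩
    exact_mod_cast (x.lt_of_mem_lower_of_mem_upper hp hu).le
  rw [eval, lt_csSup_iff hbdd (hne.image _), exists_mem_image, x.lower_rounded q]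
  simp only [Opens.mem_iSup, exists_prop, mem_ofPred_eq, Rat.cast_lt, and_comm]

theorem mem_upper (x : DReal V) {A : F} {q : ℚ} :
    A ∈ x.upper q ↔ A ∈ V ∧ x.eval A < q := by
  constructor
  · intro h
    have hA := x.upper_le q h
    rw [x.upper_rounded q] at h
    simp only [Opens.mem_iSup] at h
    obtain ⟨p, hpq, hp⟩ := h
    have hle : x.eval A ≤ p := by
      by_contra! hlt
      exact (x.lt_of_mem_lower_of_mem_upper (x.mem_lower.2 ⟨hA, hlt⟩) hp).false
    exact ⟨hA, hle.trans_lt (Rat.cast_lt.2 hpq)⟩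
  · rintro ⟨hA, h⟩
    obtain ⟨p, hp, hpq⟩ := exists_rat_btwn h
    exact (x.located p q (Rat.cast_lt.1 hpq) hA).resolve_left
      fun h' => hp.not_gt (x.mem_lower.1 h').2

theorem upper_eq_iSup_compl_lower (x : DReal V) (q : ℚ) :
    x.upper q = ⨆ (p : ℚ) (_ : p < q), V ⊓ (x.lower p)ᶜ := by
  apply le_antisymm
  · rw [x.upper_rounded q]
    exact iSup₂_mono fun p _ =>
      le_inf (x.upper_le p) (disjoint_iff.2 (x.disjoint p)).le_compl_left
  · refine iSup₂_le fun p hpq => ?_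
    calc V ⊓ (x.lower p)ᶜ ≤ (x.lower p ⊔ x.upper q) ⊓ (x.lower p)ᶜ :=
          inf_le_inf_right _ (x.located p q hpq)
      _ = x.upper q ⊓ (x.lower p)ᶜ := by rw [inf_sup_right, inf_compl_self, bot_sup_eq]
      _ ≤ x.upper q := inf_le_left

theorem continuousOn_eval (x : DReal V) : ContinuousOn x.eval V := by
  intro A hA
  refine tendsto_order.2 ⟨fun r hr => ?_, fun r hr => ?_⟩
  · obtain ⟨q, hrq, hq⟩ := exists_rat_btwn hr
    filter_upwards [mem_nhdsWithin_of_mem_nhds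
      ((x.lower q).2.mem_nhds (x.mem_lower.2 ⟨hA, hq⟩))] with B hB
    exact hrq.trans (x.mem_lower.1 hB).2
  · obtain ⟨q, hq, hqr⟩ := exists_rat_btwn hr
    filter_upwards [mem_nhdsWithin_of_mem_nhds
      ((x.upper q).2.mem_nhds (x.mem_upper.2 ⟨hA, hq⟩))] with B hB
    exact (x.mem_upper.1 hB).2.trans hqr

theorem ext_of_eval {x y : DReal V} (h : ∀ A ∈ V, x.eval A = y.eval A) : x = y := by
  ext q A
  · simp only [SetLike.mem_coe, mem_lower]
    exact and_congr_right fun hA => by rw [h A hA]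
  · simp only [SetLike.mem_coe, mem_upper]
    exact and_congr_right fun hA => by rw [h A hA]

theorem eval_eq_of_mem_lower_iff (x : DReal V) {A : F} {r : ℝ} (hA : A ∈ V)
    (h : ∀ q : ℚ, A ∈ x.lower q ↔ (q : ℝ) < r) : x.eval A = r :=
  eq_of_forall_rat_lt_iff_lt fun q => by rw [← h, x.mem_lower, and_iff_right hA]

theorem eval_restrict {W : Opens F} (h : W ≤ V) (x : DReal V) {A : F} (hA : A ∈ W) :
    (x.restrict h).eval A = x.eval A := by
  refine eval_eq_of_mem_lower_iff _ hA fun q => ?_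
  rw [← and_iff_right (h hA) (b := (q : ℝ) < _), ← x.mem_lower]
  exact and_iff_left hA

theorem eval_const (r : ℝ) (A : F) : (DReal.const r).eval A = r :=
  eval_eq_of_mem_lower_iff _ trivial fun q => by simp [DReal.const]

/-- The real number of the model given by a continuous real function on its stage; the inverse
of `DReal.eval`. -/
def ofFun (f : F → ℝ) (hf : ContinuousOn f V) : DReal V where
  lower q := ⟨{A | A ∈ V ∧ (q : ℝ) < f A}, hf.isOpen_inter_preimage V.2 isOpen_Ioi⟩
  upper q := ⟨{A | A ∈ V ∧ f A < (q : ℝ)}, hf.isOpen_inter_preimage V.2 isOpen_Iio⟩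
  lower_le _ _ h := h.1
  upper_le _ _ h := h.1
  lower_inhabited A hA := by
    obtain ⟨q, hq⟩ := exists_rat_lt (f A)
    exact Opens.mem_iSup.2 ⟨q, hA, hq⟩
  upper_inhabited A hA := by
    obtain ⟨q, hq⟩ := exists_rat_gt (f A)
    exact Opens.mem_iSup.2 ⟨q, hA, hq⟩
  lower_rounded q := by
    ext A
    simp only [SetLike.mem_coe, Opens.mem_iSup]
    constructor
    · rintro ⟨hA, h⟩
      obtain ⟨p, hqp, hp⟩ := exists_rat_btwn h
      exact ⟨p, Rat.cast_lt.1 hqp, hA, hp⟩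
    · rintro ⟨p, hqp, hA, hp⟩
      exact ⟨hA, (Rat.cast_lt.2 hqp).trans hp⟩
  upper_rounded q := by
    ext A
    simp only [SetLike.mem_coe, Opens.mem_iSup]
    constructor
    · rintro ⟨hA, h⟩
      obtain ⟨p, hp, hpq⟩ := exists_rat_btwn h
      exact ⟨p, Rat.cast_lt.1 hpq, hA, hp⟩
    · rintro ⟨p, hpq, hA, hp⟩
      exact ⟨hA, hp.trans (Rat.cast_lt.2 hpq)⟩
  disjoint q := eq_bot_iff.2 fun _ h => lt_asymm h.1.2 h.2.2
  located p q hpq A hA :=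
    (lt_or_ge (p : ℝ) (f A)).imp (fun h => ⟨hA, h⟩)
      fun h => ⟨hA, h.trans_lt (Rat.cast_lt.2 hpq)⟩

theorem eval_ofFun {f : F → ℝ} (hf : ContinuousOn f V) {A : F} (hA : A ∈ V) :
    (ofFun f hf).eval A = f A :=
  eval_eq_of_mem_lower_iff _ hA fun _ => and_iff_right hA

end DReal

theorem mem_subLt {x y : DReal V} {q : ℚ} {A : F} :
    A ∈ subLt x y q ↔ A ∈ V ∧ x.eval A - y.eval A < q := by
  simp only [subLt, Opens.mem_iSup, Opens.mem_inf, DReal.mem_lower, DReal.mem_upper, Rat.cast_add]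
  constructor
  · rintro ⟨s, ⟨hA, hx⟩, -, hy⟩
    exact ⟨hA, by linarith⟩
  · rintro ⟨hA, h⟩
    obtain ⟨s, hxs, hsy⟩ := exists_rat_btwn (sub_lt_comm.1 h)
    exact ⟨s, ⟨hA, by linarith⟩, hA, hsy⟩

theorem mem_absSubLt {x y : DReal V} {q : ℚ} {A : F} :
    A ∈ absSubLt x y q ↔ A ∈ V ∧ |x.eval A - y.eval A| < q := by
  rw [absSubLt, Opens.mem_inf, mem_subLt, mem_subLt, ← and_and_left, abs_sub_lt_iff]

theorem isSqrt_of_eval_eq {e y : DReal V} (he : ∀ A ∈ V, 0 ≤ e.eval A)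
    (hy : ∀ A ∈ V, y.eval A = e.eval A ^ 2) : IsSqrt e y := by
  refine ⟨fun q hq => ?_, fun q hq => ?_, fun q hq => ?_, fun q hq => ?_⟩ <;> ext A <;>
    simp only [SetLike.mem_coe, DReal.mem_lower, DReal.mem_upper]
  · exact and_iff_left_of_imp fun hA => (Rat.cast_lt_zero.2 hq).trans_le (he A hA)
  · refine and_congr_right fun hA => ?_
    rw [hy A hA, Rat.cast_pow, pow_lt_pow_iff_left₀ (Rat.cast_nonneg.2 hq) (he A hA) two_ne_zero]
  · exact iff_of_false (fun ⟨hA, h⟩ => ((Rat.cast_nonpos.2 hq).trans (he A hA)).not_gt h) id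
  · refine and_congr_right fun hA => ?_
    rw [hy A hA, Rat.cast_pow,
      pow_lt_pow_iff_left₀ (he A hA) (Rat.cast_nonneg.2 hq.le) two_ne_zero]

namespace DComplex

/-- The value at the point `A` of `F` of a complex number of the model, regarded as a complex
function on its stage; it is meaningful only for `A ∈ V`. -/
noncomputable def eval (z : DComplex V) (A : F) : ℂ := ⟨z.re.eval A, z.im.eval A⟩

theorem continuousOn_eval (z : DComplex V) : ContinuousOn z.eval V :=
  Complex.equivRealProdCLM.symm.continuous.comp_continuousOn
    (z.re.continuousOn_eval.prodMk z.im.continuousOn_eval)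

theorem eval_restrict {W : Opens F} (h : W ≤ V) (z : DComplex V) {A : F} (hA : A ∈ W) :
    (z.restrict h).eval A = z.eval A :=
  Complex.ext (z.re.eval_restrict h hA) (z.im.eval_restrict h hA)

theorem eval_const (z : ℂ) (A : F) : (DComplex.const z).eval A = z :=
  Complex.ext (DReal.eval_const _ _) (DReal.eval_const _ _)

end DComplex

/-! ### The set `H` has no points -/

theorem eq_bot_of_forall_eval_mem (z : DComplex V) {W : Opens F} (hWV : W ≤ V)
    (h : ∀ A ∈ W, z.eval A ∈ A.1) : W = ⊥ :=
  Opens.ext (eq_empty_of_continuousOn_selection W.2 (z.continuousOn_eval.mono hWV) h)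

theorem eval_mem_of_mem_memOpen {z : DComplex V} {N : Opens ℂ} {A : F} (h : A ∈ memOpen z N) :
    z.eval A ∈ N := by
  simp only [memOpen, Opens.mem_iSup, Opens.mem_inf, DReal.mem_lower, DReal.mem_upper] at h
  obtain ⟨a, b, c, e, hN, ⟨⟨-, ha⟩, -, hb⟩, ⟨-, hc⟩, -, he⟩ := h
  exact hN _ ha hb hc he

theorem memH_inf_normalOpen_le (z : DComplex V) (P : Set (Opens ℂ)) (hP : P.Finite) :
    memH z ⊓ normalOpen P hP ≤ memOpen z (sSup P) :=
  le_himp_iff.1 (inf_le_right.trans (iInf₂_le P hP))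

theorem eval_mem_of_mem_memH {z : DComplex V} {A : F} (h : A ∈ memH z) : z.eval A ∈ A.1 := by
  by_contra hz
  let O : Opens ℂ := ⟨{z.eval A}ᶜ, isOpen_compl_singleton⟩
  have hAO : A.1 ⊆ O := subset_compl_singleton_iff.2 hz
  have hA : A ∈ normalOpen {O} (finite_singleton O) := by
    rw [mem_normalOpen, sSup_singleton]
    refine ⟨?_, hAO⟩
    rintro _ rfl
    rw [inter_eq_left.2 hAO]
    exact A.2.2
  have hmem := eval_mem_of_mem_memOpen (memH_inf_normalOpen_le z _ _ ⟨h, hA⟩)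
  rw [sSup_singleton] at hmem
  exact hmem rfl

theorem memH_eq_bot (z : DComplex V) : memH z = ⊥ :=
  eq_bot_of_forall_eval_mem z inf_le_left fun _ => eval_mem_of_mem_memH

/-! ### Minima over finite sets -/

/-- The minimum of `g` on the finite non-empty set `A`. -/
noncomputable def minOn (g : ℂ → ℝ) (A : F) : ℝ := sInf (g '' A.1)

theorem minOn_le (g : ℂ → ℝ) {A : F} {a : ℂ} (ha : a ∈ A.1) : minOn g A ≤ g a :=
  csInf_le (A.2.1.image g).bddBelow (mem_image_of_mem g ha)

theorem exists_eq_minOn (g : ℂ → ℝ) (A : F) : ∃ a ∈ A.1, g a = minOn g A :=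
  (A.2.2.image g).csInf_mem (A.2.1.image g)

theorem lt_minOn_iff {g : ℂ → ℝ} {A : F} {r : ℝ} : r < minOn g A ↔ ∀ a ∈ A.1, r < g a := by
  rw [minOn, (A.2.1.image g).lt_csInf_iff (A.2.2.image g), forall_mem_image]

theorem minOn_lt_iff {g : ℂ → ℝ} {A : F} {r : ℝ} : minOn g A < r ↔ ∃ a ∈ A.1, g a < r := by
  rw [minOn, csInf_lt_iff (A.2.1.image g).bddBelow (A.2.2.image g), exists_mem_image]

theorem minOn_nonneg {g : ℂ → ℝ} (hg : ∀ a, 0 ≤ g a) (A : F) : 0 ≤ minOn g A :=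
  Real.sInf_nonneg (forall_mem_image.2 fun a _ => hg a)

theorem minOn_comp {φ : ℝ → ℝ} {s : Set ℝ} (hφ : MonotoneOn φ s) {g : ℂ → ℝ} {A : F}
    (hg : MapsTo g A.1 s) : minOn (φ ∘ g) A = φ (minOn g A) := by
  obtain ⟨a, ha, hga⟩ := exists_eq_minOn g A
  obtain ⟨b, hb, hφb⟩ := exists_eq_minOn (φ ∘ g) A
  rw [← hga]
  refine le_antisymm (minOn_le (φ ∘ g) ha) ?_
  rw [← hφb]
  exact hφ (hg ha) (hg hb) (hga.trans_le (minOn_le g hb))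

theorem continuous_minOn {X : Type*} [TopologicalSpace X] {g : X → ℂ → ℝ}
    (hg : Continuous (uncurry g)) : Continuous fun p : X × F => minOn (g p.1) p.2 := by
  refine continuous_iff_continuousAt.2 fun ⟨x, A⟩ =>
    tendsto_order.2 ⟨fun r hr => ?_, fun r hr => ?_⟩
  · obtain ⟨u, v, hu, hv, hxu, hAv, huv⟩ := generalized_tube_lemma isCompact_singleton
      A.2.1.isCompact (isOpen_lt continuous_const hg) (n := {p | r < uncurry g p})
      (by rintro ⟨_, a⟩ ⟨rfl, ha⟩; exact lt_minOn_iff.1 hr a ha)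
    filter_upwards [(hu.prod (isOpen_setOf_subset hv)).mem_nhds ⟨hxu rfl, hAv⟩] with p hp
    exact lt_minOn_iff.2 fun a ha => huv (mk_mem_prod hp.1 (hp.2 ha))
  · obtain ⟨a, ha, hga⟩ := minOn_lt_iff.1 hr
    obtain ⟨u, v, hu, hv, hxu, hav, huv⟩ :=
      isOpen_prod_iff.1 (isOpen_lt hg continuous_const) x a hga
    filter_upwards [(hu.prod (isOpen_setOf_inter_nonempty hv)).mem_nhds ⟨hxu, a, ha, hav⟩]
      with p hp
    obtain ⟨b, hb, hbv⟩ := hp.2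
    exact minOn_lt_iff.2 ⟨b, hb, huv (mk_mem_prod hp.1 hbv)⟩

section MinFun

variable {g : ℂ → ℂ → ℝ}

theorem continuousOn_minOn_eval (hg : Continuous (uncurry g)) (z : DComplex V) :
    ContinuousOn (fun A => minOn (g (z.eval A)) A) V :=
  (continuous_minOn hg).comp_continuousOn (z.continuousOn_eval.prodMk continuousOn_id)

/-- The function of the model that sends `z` to the real number with value `min_{a ∈ A} g (z A) a`
at the point `A` of `F`. For a metric `g` this is the distance to `H`. -/
noncomputable def minFun (g : ℂ → ℂ → ℝ) (hg : Continuous (uncurry g)) : DFun where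
  app _ z := DReal.ofFun (fun A => minOn (g (z.eval A)) A) (continuousOn_minOn_eval hg z)
  app_restrict V W h z := DReal.ext_of_eval fun A hA => by
    rw [DReal.eval_restrict h _ hA, DReal.eval_ofFun (continuousOn_minOn_eval hg _) hA,
      DReal.eval_ofFun (continuousOn_minOn_eval hg z) (h hA), z.eval_restrict h hA]

theorem eval_minFun (hg : Continuous (uncurry g)) (z : DComplex V) {A : F} (hA : A ∈ V) :
    ((minFun g hg).app V z).eval A = minOn (g (z.eval A)) A :=
  DReal.eval_ofFun (continuousOn_minOn_eval hg z) hA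

theorem eval_minFun_const (hg : Continuous (uncurry g)) (z : ℂ) (A : F) :
    ((minFun g hg).app ⊤ (DComplex.const z)).eval A = minOn (g z) A := by
  rw [eval_minFun hg _ (Opens.mem_top A), DComplex.eval_const]

theorem mem_lower_minFun_const {hg : Continuous (uncurry g)} {z : ℂ} {q : ℚ} {A : F} :
    A ∈ ((minFun g hg).app ⊤ (DComplex.const z)).lower q ↔ ∀ a ∈ A.1, (q : ℝ) < g z a := by
  rw [DReal.mem_lower, and_iff_right (Opens.mem_top A), eval_minFun_const, lt_minOn_iff]

theorem mem_upper_minFun_const {hg : Continuous (uncurry g)} {z : ℂ} {q : ℚ} {A : F} :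
    A ∈ ((minFun g hg).app ⊤ (DComplex.const z)).upper q ↔ ∃ a ∈ A.1, g z a < q := by
  rw [DReal.mem_upper, and_iff_right (Opens.mem_top A), eval_minFun_const, minOn_lt_iff]

theorem isSqrt_minFun_sq (hg : Continuous (uncurry g))
    (hg_sq : Continuous (uncurry fun z w => g z w ^ 2)) (hg_nonneg : ∀ z w, 0 ≤ g z w)
    (z : DComplex V) :
    IsSqrt ((minFun g hg).app V z) ((minFun (fun z w => g z w ^ 2) hg_sq).app V z) := by
  have hmono : MonotoneOn (fun x : ℝ => x ^ 2) (Ici 0) := fun _ hx _ _ h => pow_le_pow_left₀ hx h 2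
  refine isSqrt_of_eval_eq (fun A hA => ?_) fun A hA => ?_
  · rw [eval_minFun hg z hA]
    exact minOn_nonneg (hg_nonneg _) A
  · rw [eval_minFun hg z hA, eval_minFun hg_sq z hA]
    exact minOn_comp hmono fun a _ => hg_nonneg _ a

end MinFun

/-! ### Infima in the Riesz space -/

theorem mem_rieszEq {r s : ℂ → ℝ} {A : F} : A ∈ rieszEq r s ↔ r =ᶠ[𝓝ˢ A.1] s := by
  simp only [rieszEq, Opens.mem_iSup, EventuallyEq, eventually_nhdsSet_iff_exists]
  constructor
  · rintro ⟨P, -, N, hN, -, hAN⟩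
    exact ⟨N, N.2, hAN, hN⟩
  · rintro ⟨N, hN, hAN, h⟩
    exact ⟨∅, finite_empty, ⟨N, hN⟩, h, fun _ => False.elim, hAN⟩

theorem mem_rieszLe {r s : ℂ → ℝ} {A : F} : A ∈ rieszLe r s ↔ r ≤ᶠ[𝓝ˢ A.1] s := by
  simp only [rieszLe, mem_rieszEq, EventuallyEq, EventuallyLE, Pi.inf_apply, inf_eq_left]

theorem mem_rieszRatLt {r : ℂ → ℝ} (hr : Continuous r) {q : ℚ} {A : F} :
    A ∈ rieszRatLt q r ↔ (q : ℝ) < minOn r A := by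
  simp only [rieszRatLt, Opens.mem_iSup, mem_rieszLe]
  constructor
  · rintro ⟨p, hqp, h⟩
    refine lt_minOn_iff.2 fun a ha => (Rat.cast_lt.2 hqp).trans_le ?_
    simpa using h.self_of_nhdsSet a ha
  · intro h
    obtain ⟨p, hqp, hp⟩ := exists_rat_btwn h
    refine ⟨p, Rat.cast_lt.1 hqp, ?_⟩
    filter_upwards [(isOpen_lt continuous_const hr).mem_nhdsSet.2 (lt_minOn_iff.1 hp)] with w hw
    simpa using hw.le

theorem isRieszInf_of_eval_eq {r : ℂ → ℝ} (hr : Continuous r) {x : DReal ⊤}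
    (hx : ∀ A, x.eval A = minOn r A) : IsRieszInf r x := by
  have hlower : ∀ q, x.lower q = rieszRatLt q r := fun q => by
    ext A
    rw [SetLike.mem_coe, SetLike.mem_coe, mem_rieszRatLt hr, x.mem_lower, hx,
      and_iff_right (Opens.mem_top A)]
  exact ⟨hlower, fun q => by simp only [x.upper_eq_iSup_compl_lower, hlower, top_inf_eq]⟩

theorem isRieszInf_minFun_const {g : ℂ → ℂ → ℝ} (hg : Continuous (uncurry g)) (z : ℂ) :
    IsRieszInf (g z) ((minFun g hg).app ⊤ (DComplex.const z)) :=
  isRieszInf_of_eval_eq (hg.comp (.prodMk_right z)) (eval_minFun_const hg z)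

namespace IsRieszSubspace

variable {S : Set (ℂ → ℝ)} {f : ℂ → ℝ}

theorem abs_mem (hS : IsRieszSubspace S) (hf : f ∈ S) : |f| ∈ S :=
  hS.sup_mem _ hf _ (by simpa using hS.smul_mem (-1) _ hf)

theorem abs_sub_const_mem (hS : IsRieszSubspace S) (h1 : 1 ∈ S) (hf : f ∈ S) (c : ℝ) :
    (fun w => |f w - c|) ∈ S := by
  convert hS.abs_mem (hS.add_mem _ hf _ (hS.smul_mem (-c) _ h1)) using 1
  ext w
  simp [sub_eq_add_neg]

end IsRieszSubspace

theorem taxiElt_mem_rieszR (z : ℂ) : taxiElt z ∈ rieszR := by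
  rintro S ⟨hS, hgen⟩
  obtain ⟨h1, hre, him⟩ : 1 ∈ S ∧ Complex.re ∈ S ∧ Complex.im ∈ S := by
    simpa [generators, insert_subset_iff] using hgen
  exact hS.add_mem _ (hS.abs_sub_const_mem h1 hre z.re) _ (hS.abs_sub_const_mem h1 him z.im)

theorem euclidElt_mem_rieszRSq (z : ℂ) : euclidElt z ∈ rieszRSq := by
  rintro S ⟨hS, hsq, hgen⟩
  obtain ⟨h1, hre, him⟩ : 1 ∈ S ∧ Complex.re ∈ S ∧ Complex.im ∈ S := by
    simpa [generators, insert_subset_iff] using hgen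
  exact hS.add_mem _ (hsq _ (hS.abs_sub_const_mem h1 hre z.re))
    _ (hsq _ (hS.abs_sub_const_mem h1 him z.im))

/-! ### The distance function of a metric on the plane -/

/-- `m` is a metric on `ℂ` that is continuous and proper for the usual topology. It is a predicate
on functions, not an instance, so that two metrics can live on `ℂ` side by side. -/
structure IsPlaneMetric (m : ℂ → ℂ → ℝ) : Prop where
  self : ∀ z, m z z = 0
  comm : ∀ z w, m z w = m w z
  triangle : ∀ z w u, m z u ≤ m z w + m w u
  eq_of_eq_zero : ∀ {z w}, m z w = 0 → z = w
  continuous : Continuous (uncurry m)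
  tendsto_cocompact : ∀ z, Tendsto (m z) (cocompact ℂ) atTop

namespace IsPlaneMetric

variable {m : ℂ → ℂ → ℝ}

theorem nonneg (hm : IsPlaneMetric m) (z w : ℂ) : 0 ≤ m z w := by
  linarith [hm.self z, hm.comm z w, hm.triangle z w z]

theorem minOn_le_add (hm : IsPlaneMetric m) (z w : ℂ) (A : F) :
    minOn (m z) A ≤ m z w + minOn (m w) A := by
  obtain ⟨a, ha, hwa⟩ := exists_eq_minOn (m w) A
  rw [← hwa]
  exact (minOn_le _ ha).trans (hm.triangle z w a)

theorem mem_of_minOn_nonpos (hm : IsPlaneMetric m) {z : ℂ} {A : F} (h : minOn (m z) A ≤ 0) :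
    z ∈ A.1 := by
  obtain ⟨a, ha, hza⟩ := exists_eq_minOn (m z) A
  rwa [hm.eq_of_eq_zero (le_antisymm (hza.trans_le h) (hm.nonneg z a))]

theorem exists_forall_lt (hm : IsPlaneMetric m) (K : ℝ) (A : F) : ∃ z, ∀ a ∈ A.1, K < m z a := by
  have h : ∀ᶠ z in cocompact ℂ, ∀ a ∈ A.1, K < m a z :=
    A.2.1.eventually_all.2 fun a _ => (hm.tendsto_cocompact a).eventually_gt_atTop K
  obtain ⟨z, hz⟩ := h.exists
  exact ⟨z, fun a ha => hm.comm a z ▸ hz a ha⟩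

theorem inf_compl_lower_zero_minFun (hm : IsPlaneMetric m) (z : DComplex V) :
    V ⊓ (((minFun m hm.continuous).app V z).lower 0)ᶜ = ⊥ := by
  refine eq_bot_of_forall_eval_mem z inf_le_left fun A ⟨hA, hA0⟩ => hm.mem_of_minOn_nonpos ?_
  by_contra! hpos
  refine notMem_of_mem_compl hA0 ((DReal.mem_lower _).2 ⟨hA, ?_⟩)
  rwa [eval_minFun _ z hA, Rat.cast_zero]

theorem isNontrivialDistanceToH_minFun (hm : IsPlaneMetric m)
    {mLt : ∀ V : Opens F, DComplex V → DComplex V → ℚ → Opens F}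
    (hmLt : ∀ {V : Opens F} {z w : DComplex V} {q : ℚ} {A : F}, A ∈ mLt V z w q →
      A ∈ V ∧ m (z.eval A) (w.eval A) < q) :
    IsNontrivialDistanceToH m mLt (minFun m hm.continuous) where
  nonneg V z q hq := by
    refine le_antisymm (DReal.lower_le _ q) fun A hA => (DReal.mem_lower _).2 ⟨hA, ?_⟩
    rw [eval_minFun _ z hA]
    exact (Rat.cast_lt_zero.2 hq).trans_le (minOn_nonneg (hm.nonneg _) A)
  lipschitz V z w q A h := by
    obtain ⟨hA, hzw⟩ := hmLt h
    refine mem_subLt.2 ⟨hA, ?_⟩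
    rw [eval_minFun _ z hA, eval_minFun _ w hA]
    linarith [hm.minOn_le_add (z.eval A) (w.eval A) A]
  zero_iff V z := by rw [hm.inf_compl_lower_zero_minFun, memH_eq_bot]
  lower_bound P hP z q hq := by
    refine eq_bot_iff.2 fun A ⟨hA, hAq⟩ => ?_
    obtain ⟨a, ha, hza⟩ := mem_upper_minFun_const.1 hAq
    exact (hq a ((mem_normalOpen.1 hA).2 ha)).not_gt hza
  upper_bound P hP ε z q hdiam hq A hA := by
    obtain ⟨w, hw, hwq⟩ := hq
    obtain ⟨O, hO, hwO⟩ := Opens.mem_sSup.1 hw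
    obtain ⟨a, ha, haO⟩ := (mem_normalOpen.1 hA).1 O hO
    exact mem_upper_minFun_const.2
      ⟨a, ha, by linarith [hdiam O hO w hwO a haO, hm.triangle z w a]⟩
  exists_small ε hε := eq_top_iff.2 fun A _ => by
    obtain ⟨a, ha⟩ := A.2.2
    exact Opens.mem_iSup.2
      ⟨a, mem_upper_minFun_const.2 ⟨a, ha, (hm.self a).trans_lt (Rat.cast_pos.2 hε)⟩⟩
  exists_large K := eq_top_iff.2 fun A _ => by
    obtain ⟨z, hz⟩ := hm.exists_forall_lt K A
    exact Opens.mem_iSup.2 ⟨z, mem_lower_minFun_const.2 hz⟩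

end IsPlaneMetric

/-! ### The two metrics -/

theorem dist_le_taxi (z w : ℂ) : dist z w ≤ taxi z w := by
  rw [Complex.dist_eq]
  exact Complex.norm_le_abs_re_add_abs_im (z - w)

theorem dist_sq (z w : ℂ) : dist z w ^ 2 = |z.re - w.re| ^ 2 + |z.im - w.im| ^ 2 := by
  rw [Complex.dist_eq, Complex.sq_norm, Complex.normSq_apply, sq_abs, sq_abs, Complex.sub_re,
    Complex.sub_im, sq, sq]

theorem isPlaneMetric_dist : IsPlaneMetric fun z w => dist z w where
  self := dist_self
  comm := dist_comm
  triangle := dist_triangle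
  eq_of_eq_zero := eq_of_dist_eq_zero
  continuous := continuous_dist
  tendsto_cocompact := tendsto_dist_left_cocompact_atTop

theorem isPlaneMetric_taxi : IsPlaneMetric taxi where
  self z := by simp [taxi]
  comm z w := by simp only [taxi, abs_sub_comm]
  triangle z w u := by
    unfold taxi
    linarith [abs_sub_le z.re w.re u.re, abs_sub_le z.im w.im u.im]
  eq_of_eq_zero {z w} h := eq_of_dist_eq_zero (le_antisymm (h ▸ dist_le_taxi z w) dist_nonneg)
  continuous := by
    unfold taxi uncurry
    fun_prop
  tendsto_cocompact z :=
    tendsto_atTop_mono (dist_le_taxi z) (tendsto_dist_left_cocompact_atTop z)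

theorem taxi_lt_of_mem_taxiLt {z w : DComplex V} {q : ℚ} {A : F} (h : A ∈ taxiLt V z w q) :
    A ∈ V ∧ taxi (z.eval A) (w.eval A) < q := by
  simp only [taxiLt, Opens.mem_iSup, Opens.mem_inf, mem_absSubLt] at h
  obtain ⟨a, b, hab, ⟨hA, hre⟩, -, him⟩ := h
  have hab : (a : ℝ) + b ≤ q := mod_cast hab
  exact ⟨hA, (add_lt_add hre him).trans_le hab⟩

theorem dist_lt_of_mem_euclidLt {z w : DComplex V} {q : ℚ} {A : F} (h : A ∈ euclidLt V z w q) :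
    A ∈ V ∧ dist (z.eval A) (w.eval A) < q := by
  simp only [euclidLt, Opens.mem_iSup, Opens.mem_inf, mem_absSubLt] at h
  obtain ⟨a, b, ⟨hq, hab⟩, ⟨hA, hre⟩, -, him⟩ := h
  have hab : (a : ℝ) ^ 2 + (b : ℝ) ^ 2 ≤ (q : ℝ) ^ 2 := mod_cast hab
  refine ⟨hA, lt_of_pow_lt_pow_left₀ 2 (Rat.cast_nonneg.2 hq.le) ?_⟩
  calc dist (z.eval A) (w.eval A) ^ 2
      = |z.re.eval A - w.re.eval A| ^ 2 + |z.im.eval A - w.im.eval A| ^ 2 := dist_sq _ _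
    _ < (a : ℝ) ^ 2 + (b : ℝ) ^ 2 := by gcongr
    _ ≤ (q : ℝ) ^ 2 := hab

theorem taxiElt_eq (z : ℂ) : taxiElt z = taxi z := by
  ext w
  simp only [taxiElt, taxi, abs_sub_comm]

theorem euclidElt_eq (z : ℂ) : euclidElt z = fun w => dist z w ^ 2 := by
  ext w
  rw [dist_comm, dist_sq, euclidElt]

end PointlessModel

theorem proposition11 :
    -- no stage forces anything to be a member of `H`
    (∀ (V : Opens F) (z : DComplex V), memH z = ⊥) ∧
    -- the taxicab distance function to `H`
    (∃ d : DFun, IsNontrivialDistanceToH taxi taxiLt d ∧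
      ∀ z : ℂ, taxiElt z ∈ rieszR ∧
        IsRieszInf (taxiElt z) (d.app ⊤ (DComplex.const z))) ∧
    -- the Euclidean distance function to `H`
    (∃ d : DFun, IsNontrivialDistanceToH (fun z w => dist z w) euclidLt d ∧
      ∀ z : ℂ, euclidElt z ∈ rieszRSq ∧
        ∃ y : DReal ⊤, IsRieszInf (euclidElt z) y ∧
          IsSqrt (d.app ⊤ (DComplex.const z)) y) := by
  have hdist_sq : Continuous (Function.uncurry fun z w : ℂ => dist z w ^ 2) :=
    isPlaneMetric_dist.continuous.pow 2
  refine ⟨fun _ => memH_eq_bot, ⟨minFun taxi isPlaneMetric_taxi.continuous, ?_, fun z => ?_⟩,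
    ⟨minFun (fun z w => dist z w) isPlaneMetric_dist.continuous, ?_, fun z => ?_⟩⟩
  · exact isPlaneMetric_taxi.isNontrivialDistanceToH_minFun taxi_lt_of_mem_taxiLt
  · refine ⟨taxiElt_mem_rieszR z, ?_⟩
    rw [taxiElt_eq]
    exact isRieszInf_minFun_const isPlaneMetric_taxi.continuous z
  · exact isPlaneMetric_dist.isNontrivialDistanceToH_minFun dist_lt_of_mem_euclidLt
  · refine ⟨euclidElt_mem_rieszRSq z, (minFun _ hdist_sq).app ⊤ (DComplex.const z), ?_, ?_⟩
    · rw [euclidElt_eq]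
      exact isRieszInf_minFun_const hdist_sq z
    · exact isSqrt_minFun_sq isPlaneMetric_dist.continuous hdist_sq isPlaneMetric_dist.nonneg _
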